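/- Let $C>0$ and $R$ be real constants. There exist a constant $c>0$ and an integer $N$, depending only on $C$ and $R$, such that the following holds for every $n\ge N$ with $m=\lceil Cn+R\rceil\ge 0$, every prime power $q$, and all vector spaces $V$ and $W$ over the finite field $\mathbb{F}_q$ with $\dim V=n$ and $\dim W=m$. Let $P\in\mathrm{GL}(V)$ act on $V\wedge V\oplus V$ by $(v_1\wedge v_2,v_3)\mapsto(Pv_1\wedge Pv_2,Pv_3)$, and let $(P,Q)\in\mathrm{GL}(V)\times\mathrm{GL}(W)$ act on $(V\wedge V\oplus V)\otimes W$ by $x\otimes w\mapsto Px\otimes Qw$. (1) The number of orbits of $\mathrm{GL}(V)\times\mathrm{GL}(W)$ on $(V\wedge V\oplus V)\otimes W$ is at most $$\left(q-1+\frac{1}{q^{cn^2}}\right)\cdot\frac{q^{\left(\binom n2+n\right)m}}{|\mathrm{GL}(V)|\cdot|\mathrm{GL}(W)|}.$$ (2) Let $K=q^{m^2}/|\mathrm{GL}(m,q)|$ and let $\mathrm{Gr}(V\wedge V\oplus V,m)$ be the set of $m$-dimensional subspaces of $V\wedge V\oplus V$. The number of orbits of $\mathrm{GL}(V)$ on $\mathrm{Gr}(V\wedge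 V\oplus V,m)$ is at most $$K\cdot\left(q-1+\frac{1}{q^{cn^2}}\right)\cdot\frac{|\mathrm{Gr}(V\wedge V\oplus V,m)|}{|\mathrm{GL}(V)|}.$$ -/

import Mathlib

open scoped TensorProduct

universe u v w

namespace OrbitCount

section

variable {F : Type u} [Field F]

/-- The set `Gr(M, m)` of `m`-dimensional subspaces of a vector space `M`. -/
abbrev Gr (F : Type u) [Field F] (M : Type v) [AddCommMonoid M] [Module F M] (m : ℕ) : Type v :=
  {S : Submodule F M // Module.finrank F S = m}

/-- The action of a group on the set of vectors of a linear representation. -/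
abbrev vectorAction {G : Type v} [Group G] {M : Type w} [AddCommMonoid M] [Module F M]
    (ρ : Representation F G M) : MulAction G M where
  smul g x := ρ g x
  one_smul x := by
    change ρ 1 x = x
    simp
  mul_smul g h x := by
    change ρ (g * h) x = ρ g (ρ h x)
    simp

/-- The induced action of a group on the `m`-dimensional subspaces of a linear representation:
`g` sends a subspace `S` to its image under `g`. -/
abbrev subspaceAction {G : Type v} [Group G] {M : Type w} [AddCommMonoid M] [Module F M]
    (ρ : Representation F G M) (m : ℕ) : MulAction G (Gr F M m) where
  smul g S := ⟨S.1.map (ρ g), by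
    have hinj : Function.Injective (ρ g) := by
      intro x y hxy
      have h := congrArg (ρ g⁻¹) hxy
      simpa using h
    exact (Submodule.equivMapOfInjective (ρ g) hinj S.1).finrank_eq.symm.trans S.2⟩
  one_smul S := by
    apply Subtype.ext
    change S.1.map (ρ 1) = S.1
    rw [map_one]
    exact Submodule.map_id _
  mul_smul g h S := by
    apply Subtype.ext
    change S.1.map (ρ (g * h)) = (S.1.map (ρ h)).map (ρ g)
    rw [map_mul]
    exact Submodule.map_comp _ _ _

/-- The number of orbits of a group action. -/
noncomputable def numOrbits {G : Type v} [Group G] {X : Type w} (a : MulAction G X) : ℕ :=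
  Nat.card (@MulAction.orbitRel.Quotient G X _ a)

variable (F) (V : Type v) [AddCommGroup V] [Module F V] (W : Type w) [AddCommGroup W] [Module F W]

/-- The space `V ∧ V ⊕ V`. -/
abbrev WedgeSum : Type (max u v) := (⋀[F]^2 V) × V

/-- The natural action of `GL(V)` on `V ∧ V ⊕ V`:
`P` sends `(v₁ ∧ v₂, v₃)` to `(P v₁ ∧ P v₂, P v₃)`. -/
noncomputable def wedgeSumRep :
    Representation F (LinearMap.GeneralLinearGroup F V) (WedgeSum F V) where
  toFun P := (exteriorPower.map 2 (P : V →ₗ[F] V)).prodMap (P : V →ₗ[F] V)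
  map_one' := by
    rw [Units.val_one, Module.End.one_eq_id, exteriorPower.map_id, LinearMap.prodMap_id]
    rfl
  map_mul' P Q := by
    rw [Units.val_mul, Module.End.mul_eq_comp, exteriorPower.map_comp]
    rfl

/-- The natural action of `GL(V) × GL(W)` on `(V ∧ V ⊕ V) ⊗ W`:
`(P, Q)` sends `x ⊗ w` to `(P x) ⊗ (Q w)`. -/
noncomputable def tensorRep :
    Representation F (LinearMap.GeneralLinearGroup F V × LinearMap.GeneralLinearGroup F W)
      (WedgeSum F V ⊗[F] W) where
  toFun g := TensorProduct.map (wedgeSumRep F V g.1) (g.2 : W →ₗ[F] W)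
  map_one' := by
    rw [Prod.fst_one, Prod.snd_one, map_one]
    exact TensorProduct.map_one
  map_mul' g h := by
    rw [Prod.fst_mul, Prod.snd_mul, map_mul]
    exact TensorProduct.map_mul _ _ _ _

/-- The number of orbits of `GL(V) × GL(W)` on `(V ∧ V ⊕ V) ⊗ W`. -/
noncomputable def gTensor : ℕ := numOrbits (vectorAction (tensorRep F V W))

/-- The number of orbits of `GL(V)` on the `m`-dimensional subspaces of `V ∧ V ⊕ V`. -/
noncomputable def gSubspace (m : ℕ) : ℕ := numOrbits (subspaceAction (wedgeSumRep F V) m)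

end

end OrbitCount

/-! By Burnside's lemma the number of orbits on `(V ∧ V ⊕ V) ⊗ W`, divided by the main term, equals
the sum over `g` of `q ^ (-k(g))`, where `k(g)` is the rank of `g - 1`. The identity contributes 1,
which is at most `q - 1`, so it suffices that all other `g = (P, Q)` together contribute at most `q
^ (-c n ^ 2)`.

Let `r` and `s` be the ranks of `P - a` and `Q - b` for suitable scalars. An operator at rank
distance `r` from the scalars moves some subspace `Y` of dimension about `r / 3` off itself
(`exists_displaces`). Wedging `Y` with a complement of `Y + P Y` gives a displaced subspace of `V ∧
V` of dimension of order `r n`, and tensoring with `W` gives `k` at least of order `r n m`. Likewise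
`k` is at least of order `s n ^ 2`. If both components are scalar, `g` acts by `a ^ 2 b` on one
summand and by `a b` on the other, and these are both 1 only for `g = 1`; hence `k ≥ n m`
(`exists_codim_bounds`). On the other side, at most `q ^ (2 n r)` endomorphisms of `V` have rank
`r`. As `m` is of order `n`, `k` exceeds `2 n r + 2 m s` by a multiple of `n ^ 2`, and the sum is
small.

For subspaces, every `m`-dimensional subspace is the image of the contraction `W* → V ∧ V ⊕ V` by
some tensor, and this image is equivariant, so there are no more orbits on subspaces than on
tensors. The factor `K` appears when `q ^ (m (D - m)) ≤ |Gr|`, with `D = dim (V ∧ V ⊕ V)`, is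
inserted in the bound for tensors. -/

namespace OrbitCount

/-! ### Displaced subspaces, tensor products and exterior squares -/

section LinearAlgebra

variable {F : Type u} [Field F] {U : Type v} [AddCommGroup U] [Module F U]
  {W : Type w} [AddCommGroup W] [Module F W]

/-- `A` displaces a `k`-dimensional subspace: there are a `k`-dimensional subspace `Y` and a
projection onto `Y` which kills `A Y`. -/
def Displaces (A : Module.End F U) (k : ℕ) : Prop :=
  ∃ (i : (Fin k → F) →ₗ[F] U) (p : U →ₗ[F] (Fin k → F)),
    (∀ x, p (i x) = x) ∧ ∀ x, p (A (i x)) = 0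

theorem Displaces.of_finrank {A : Module.End F U} {M : Type*} [AddCommGroup M] [Module F M]
    [FiniteDimensional F M] (i : M →ₗ[F] U) (p : U →ₗ[F] M)
    (hpi : ∀ x, p (i x) = x) (hpA : ∀ x, p (A (i x)) = 0) :
    Displaces A (Module.finrank F M) := by
  let e := (Module.finBasis F M).equivFun
  refine ⟨i ∘ₗ e.symm.toLinearMap, e.toLinearMap ∘ₗ p, fun x => by simp [hpi],
    fun x => by simp [hpA]⟩

theorem Displaces.mono {A : Module.End F U} {k l : ℕ} (h : Displaces A k) (hlk : l ≤ k) :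
    Displaces A l := by
  obtain ⟨i, p, hpi, hpA⟩ := h
  have hsurj : Function.Surjective (LinearMap.funLeft F F (Fin.castLE hlk)) :=
    LinearMap.funLeft_surjective_of_injective F F _ (Fin.castLE_injective hlk)
  obtain ⟨s, hs⟩ := LinearMap.exists_rightInverse_of_surjective _ (LinearMap.range_eq_top.2 hsurj)
  refine ⟨i ∘ₗ s, LinearMap.funLeft F F (Fin.castLE hlk) ∘ₗ p, fun x => ?_, fun x => ?_⟩
  · rw [LinearMap.comp_apply, LinearMap.comp_apply, hpi]
    exact LinearMap.congr_fun hs x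
  · rw [LinearMap.comp_apply, LinearMap.comp_apply, hpA, map_zero]

theorem finrank_le_finrank_range_of_comp {M : Type*} [AddCommGroup M] [Module F M]
    [FiniteDimensional F U] (T : Module.End F U) (i : M →ₗ[F] U) (p : U →ₗ[F] M) {c : F}
    (hc : c ≠ 0) (h : ∀ x, p (T (i x)) = c • x) :
    Module.finrank F M ≤ Module.finrank F (LinearMap.range T) := by
  have hs : Function.Surjective (p ∘ₗ (LinearMap.range T).subtype) := fun x =>
    ⟨⟨T (i (c⁻¹ • x)), LinearMap.mem_range_self _ _⟩, by simp [h, smul_smul, hc]⟩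
  exact LinearMap.finrank_le_finrank_of_surjective hs

theorem update_vecCons_one {M : Type*} (x y z : M) : Function.update ![x, y] 1 z = ![x, z] := by
  ext t
  fin_cases t <;> rfl

/-- The linear map `a ∧ b ↦ p a ⊗ q b - p b ⊗ q a`. -/
noncomputable def wedgeToTensor {M N : Type*} [AddCommGroup M] [Module F M] [AddCommGroup N]
    [Module F N] (p : U →ₗ[F] M) (q : U →ₗ[F] N) : (⋀[F]^2 U) →ₗ[F] M ⊗[F] N :=
  exteriorPower.alternatingMapLinearEquiv
    { toFun := fun v => p (v 0) ⊗ₜ[F] q (v 1) - p (v 1) ⊗ₜ[F] q (v 0)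
      map_update_add' := by
        intro _ v i x y
        fin_cases i
        · simp [TensorProduct.add_tmul, TensorProduct.tmul_add]
          abel
        · simp [TensorProduct.add_tmul, TensorProduct.tmul_add]
          abel
      map_update_smul' := by
        intro _ v i c x
        fin_cases i <;> simp [TensorProduct.smul_tmul', smul_sub]
      map_eq_zero_of_eq' := by
        intro v i j hv hij
        fin_cases i <;> fin_cases j <;> simp_all }

@[simp]
theorem wedgeToTensor_apply {M N : Type*} [AddCommGroup M] [Module F M] [AddCommGroup N]
    [Module F N] (p : U →ₗ[F] M) (q : U →ₗ[F] N) (a b : U) :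
    wedgeToTensor p q (exteriorPower.ιMulti F 2 ![a, b]) = p a ⊗ₜ q b - p b ⊗ₜ q a := by
  rw [wedgeToTensor, exteriorPower.alternatingMapLinearEquiv_apply_ιMulti]
  rfl

/-- The linear map `x ⊗ y ↦ i x ∧ j y`. -/
noncomputable def tensorToWedge {M N : Type*} [AddCommGroup M] [Module F M] [AddCommGroup N]
    [Module F N] (i : M →ₗ[F] U) (j : N →ₗ[F] U) : M ⊗[F] N →ₗ[F] (⋀[F]^2 U) :=
  TensorProduct.lift (LinearMap.mk₂ F (fun x y => exteriorPower.ιMulti F 2 ![i x, j y])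
    (fun x x' y => by
      simpa using (exteriorPower.ιMulti F 2).map_vecCons_add ![j y] (i x) (i x'))
    (fun c x y => by
      simpa using (exteriorPower.ιMulti F 2).map_vecCons_smul ![j y] c (i x))
    (fun x y y' => by
      have h := (exteriorPower.ιMulti F 2).map_update_add ![i x, 0] 1 (j y) (j y')
      simp only [update_vecCons_one] at h
      simpa only [map_add, map_smul] using h)
    (fun c x y => by
      have h := (exteriorPower.ιMulti F 2).map_update_smul ![i x, 0] 1 c (j y)
      simp only [update_vecCons_one] at h
      simpa only [map_add, map_smul] using h))

@[simp]
theorem tensorToWedge_tmul {M N : Type*} [AddCommGroup M] [Module F M] [AddCommGroup N]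
    [Module F N] (i : M →ₗ[F] U) (j : N →ₗ[F] U) (x : M) (y : N) :
    tensorToWedge i j (x ⊗ₜ y) = exteriorPower.ιMulti F 2 ![i x, j y] :=
  rfl

variable [FiniteDimensional F U] [FiniteDimensional F W]

/-- The compression of `A ⊗ B` to `Y ⊗ W` vanishes whatever `B` is, so that of `A ⊗ B - 1` is `-1`,
which is invertible. -/
theorem Displaces.le_finrank_range_map_sub_one {A : Module.End F U} {k : ℕ} (h : Displaces A k)
    (B : Module.End F W) :
    k * Module.finrank F W ≤
      Module.finrank F (LinearMap.range (TensorProduct.map A B - 1)) := by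
  obtain ⟨i, p, hpi, hpA⟩ := h
  have := finrank_le_finrank_range_of_comp (TensorProduct.map A B - 1)
    (TensorProduct.map i (LinearMap.id (M := W))) (TensorProduct.map p (LinearMap.id (M := W)))
    (neg_ne_zero.2 one_ne_zero) (fun x => by
      induction x with
      | zero => simp
      | tmul x y => simp [hpi, hpA]
      | add x y hx hy => rw [map_add, map_add, map_add, hx, hy, smul_add])
  simpa [Module.finrank_tensorProduct] using this

theorem Displaces.le_finrank_range_map_sub_one_right {B : Module.End F W} {k : ℕ}
    (h : Displaces B k) (A : Module.End F U) :
    k * Module.finrank F U ≤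
      Module.finrank F (LinearMap.range (TensorProduct.map A B - 1)) := by
  obtain ⟨i, p, hpi, hpB⟩ := h
  have := finrank_le_finrank_range_of_comp (TensorProduct.map A B - 1)
    (TensorProduct.map (LinearMap.id (M := U)) i) (TensorProduct.map (LinearMap.id (M := U)) p)
    (neg_ne_zero.2 one_ne_zero) (fun x => by
      induction x with
      | zero => simp
      | tmul x y => simp [hpi, hpB]
      | add x y hx hy => rw [map_add, map_add, map_add, hx, hy, smul_add])
  simpa [Module.finrank_tensorProduct, mul_comm] using this

/-- An endomorphism displaces a subspace of at least a third of the dimension that its distance to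
the scalars allows. -/
theorem exists_displaces (B : Module.End F U) :
    ∃ (c : F) (t : ℕ), Module.finrank F (LinearMap.range (B - c • 1)) ≤ 3 * t ∧
      Displaces B t := by
  by_contra! hcon
  -- If the claim fails, a subspace `Y` with `Y` and `B Y` independent can be enlarged forever, one
  -- vector at a time.
  have key : ∀ t : ℕ, ∃ Y : Submodule F U, Module.finrank F Y ≤ t ∧
      2 * t ≤ Module.finrank F ↥(Y ⊔ Y.map B) := by
    intro t
    induction t with
    | zero => exact ⟨⊥, by simp⟩
    | succ t ih =>
      obtain ⟨Y, hY, hX⟩ := ih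
      set X := Y ⊔ Y.map B with hXdef
      have hmap : Module.finrank F (Y.map B) ≤ Module.finrank F Y := Submodule.finrank_map_le B Y
      have hsum := Submodule.finrank_sup_add_finrank_inf_eq Y (Y.map B)
      rw [← hXdef] at hsum
      have hdisp : Displaces B t := by
        have hinf : Module.finrank F ↥(Y ⊓ Y.map B) = 0 := by omega
        have hdis : Disjoint (Y.map B) Y := by
          rw [disjoint_comm, disjoint_iff]
          exact Submodule.finrank_eq_zero.1 hinf
        obtain ⟨Z, hZ, hc⟩ := hdis.exists_isCompl
        have hYt : Module.finrank F Y = t := by omega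
        rw [← hYt]
        exact Displaces.of_finrank Y.subtype (Y.projectionOnto Z hc.symm) (by simp)
          (fun x => (Submodule.projectionOnto_apply_eq_zero_iff _).2
            (hZ (Submodule.mem_map_of_mem x.2)))
      by_contra! hno
      -- When no vector `v` can be added to `Y`, `B` fixes every line modulo `X`; it will follow
      -- that `B` is scalar modulo `X`.
      have hdep : ∀ v, v ∉ X → B v ∈ X ⊔ Submodule.span F {v} := by
        intro v hv
        by_contra hBv
        have h1 : X < X ⊔ Submodule.span F {v} :=
          left_lt_sup.2 (by simpa [Submodule.span_singleton_le_iff_mem] using hv)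
        have h2 : X ⊔ Submodule.span F {v} <
            X ⊔ Submodule.span F {v} ⊔ Submodule.span F {B v} :=
          left_lt_sup.2 (by simpa [Submodule.span_singleton_le_iff_mem] using hBv)
        have h3 := Submodule.finrank_lt_finrank_of_lt h1
        have h4 := Submodule.finrank_lt_finrank_of_lt h2
        have h5 := hno (Y ⊔ Submodule.span F {v})
          ((Submodule.finrank_add_le_finrank_add_finrank _ _).trans
            (add_le_add hY (by simpa using finrank_span_le_card (R := F) {v})))
        have h6 : Y ⊔ Submodule.span F {v} ⊔ (Y ⊔ Submodule.span F {v}).map B =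
            X ⊔ Submodule.span F {v} ⊔ Submodule.span F {B v} := by
          rw [Submodule.map_sup, Submodule.map_span, Set.image_singleton, hXdef]
          ac_rfl
        rw [h6] at h5
        omega
      have hXt : Module.finrank F X ≤ 2 * t := by omega
      have hbig : ∀ c : F, 3 * t < Module.finrank F (LinearMap.range (B - c • 1)) := fun c =>
        not_le.1 fun h => hcon c t h hdisp
      have hU : 3 * t < Module.finrank F U := (hbig 0).trans_le (Submodule.finrank_le _)
      have hex : ∀ S : Submodule F U, Module.finrank F S < Module.finrank F U → ∃ v, v ∉ S := by
        intro S hS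
        by_contra! h
        rw [(Submodule.eq_top_iff' (p := S)).2 h, finrank_top] at hS
        exact lt_irrefl _ hS
      have hinv : X ≤ X.comap B := by
        intro x hx
        -- For `t = 0` there may be no room for two vectors independent modulo `X`, but then `X =
        -- 0`. For `t ≥ 1` the factor 3 gives the room, since `2 * t + 1 ≤ 3 * t < dim U`; then `B
        -- x` lies in both `X + ⟨v⟩` and `X + ⟨v'⟩`, which meet in `X`.
        rcases Nat.eq_zero_or_pos t with rfl | ht
        · have : X = ⊥ := Submodule.finrank_eq_zero.1 (by omega)
          rw [this, Submodule.mem_bot] at hx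
          simp [hx]
        have hmem : ∀ v, v ∉ X → B x ∈ X ⊔ Submodule.span F {v} := by
          intro v hv
          have h1 := hdep v hv
          have h2 := hdep (x + v) fun h => hv ((Submodule.add_mem_iff_right _ hx).1 h)
          have h3 : X ⊔ Submodule.span F {x + v} ≤ X ⊔ Submodule.span F {v} := by
            refine sup_le le_sup_left ((Submodule.span_singleton_le_iff_mem _ _).2 ?_)
            exact Submodule.add_mem_sup hx (Submodule.mem_span_singleton_self v)
          rw [map_add] at h2
          exact (Submodule.add_mem_iff_left _ h1).1 (h3 h2)
        obtain ⟨v, hv⟩ := hex X (by omega)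
        obtain ⟨v', hv'⟩ := hex (X ⊔ Submodule.span F {v}) (by
          have h1 := Submodule.finrank_add_le_finrank_add_finrank X (Submodule.span F {v})
          have h2 : Module.finrank F (Submodule.span F {v}) ≤ 1 := by
            simpa using finrank_span_le_card (R := F) {v}
          omega)
        obtain ⟨y', hy', z', hz', hyz'⟩ := Submodule.mem_sup.1
          (hmem v' fun h => hv' (Submodule.mem_sup_left h))
        obtain ⟨a, rfl⟩ := Submodule.mem_span_singleton.1 hz'
        rcases eq_or_ne a 0 with rfl | ha
        · rw [zero_smul, add_zero] at hyz'
          rw [Submodule.mem_comap, ← hyz']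
          exact hy'
        · refine absurd ?_ hv'
          have h1 := hmem v hv
          rw [← hyz', Submodule.add_mem_iff_right _ (Submodule.mem_sup_left hy')] at h1
          exact (Submodule.smul_mem_iff _ ha).1 h1
      obtain ⟨c, hc⟩ := LinearMap.exists_eq_smul_id_of_forall_notLinearIndependent
        (f := X.mapQ X B hinv) (by
          intro y hy
          obtain ⟨v, rfl⟩ := X.mkQ_surjective y
          rw [LinearIndependent.pair_iff' (by
            simpa using hy.ne_zero 0)] at hy
          have hv : v ∉ X := fun h => by
            apply hy 0
            rw [zero_smul]
            exact ((Submodule.Quotient.mk_eq_zero X).2 (hinv h)).symm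
          obtain ⟨y', hy', z', hz', hyz'⟩ := Submodule.mem_sup.1 (hdep v hv)
          obtain ⟨a, rfl⟩ := Submodule.mem_span_singleton.1 hz'
          apply hy a
          rw [Submodule.mkQ_apply, Submodule.mapQ_apply, ← hyz', Submodule.Quotient.mk_add,
            (Submodule.Quotient.mk_eq_zero X).2 hy', zero_add, Submodule.Quotient.mk_smul])
      -- The rank of `B - c` is thus at most `2 * t`, against `hbig`.
      have hle : LinearMap.range (B - c • 1) ≤ X := by
        rintro _ ⟨x, rfl⟩
        have := LinearMap.congr_fun hc (X.mkQ x)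
        rw [← Submodule.Quotient.mk_eq_zero]
        simpa [sub_eq_zero] using this
      have := Submodule.finrank_mono hle
      have := hbig c
      omega
  obtain ⟨Y, -, h⟩ := key (Module.finrank F U + 1)
  have := Submodule.finrank_le (Y ⊔ Y.map B)
  omega

/-- A linear map onto `F ^ l` that vanishes on a given subspace of codimension at least `l`. -/
theorem exists_surjective_of_finrank_add_le (X : Submodule F U) {l : ℕ}
    (h : Module.finrank F X + l ≤ Module.finrank F U) :
    ∃ p : U →ₗ[F] (Fin l → F), Function.Surjective p ∧ ∀ x ∈ X, p x = 0 := by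
  have hl : l ≤ Module.finrank F (U ⧸ X) := by
    have := X.finrank_quotient_add_finrank
    omega
  refine ⟨LinearMap.funLeft F F (Fin.castLE hl) ∘ₗ
    (Module.finBasis F (U ⧸ X)).equivFun.toLinearMap ∘ₗ X.mkQ, ?_, fun x hx => ?_⟩
  · rw [LinearMap.coe_comp, LinearMap.coe_comp]
    exact (LinearMap.funLeft_surjective_of_injective F F _ (Fin.castLE_injective hl)).comp
      ((Module.finBasis F (U ⧸ X)).equivFun.surjective.comp X.mkQ_surjective)
  · rw [LinearMap.comp_apply, LinearMap.comp_apply, Submodule.mkQ_apply,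
      (Submodule.Quotient.mk_eq_zero X).2 hx, map_zero, map_zero]

/-- Take `Z` of dimension `l` independent of `Y + A Y`, and `q` a projection to `Z` that kills `Y +
A Y`. Then `Y ⊗ Z` embeds in the exterior square with retraction `p ∧ q`. This retraction kills `A y
∧ A z`, because both `p (A y)` and `q (A y)` vanish. -/
theorem Displaces.exteriorPower_two {A : Module.End F U} {k l : ℕ} (h : Displaces A k)
    (hl : 2 * k + l ≤ Module.finrank F U) : Displaces (exteriorPower.map 2 A) (k * l) := by
  obtain ⟨i, p, hpi, hpA⟩ := h
  obtain ⟨q, hq, hqX⟩ := exists_surjective_of_finrank_add_le (l := l)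
    (LinearMap.range i ⊔ LinearMap.range (A ∘ₗ i)) (by
      have h1 := Submodule.finrank_add_le_finrank_add_finrank (LinearMap.range i)
        (LinearMap.range (A ∘ₗ i))
      have h2 := LinearMap.finrank_range_le i
      have h3 := LinearMap.finrank_range_le (A ∘ₗ i)
      rw [Module.finrank_fin_fun] at h2 h3
      omega)
  obtain ⟨j, hj⟩ := LinearMap.exists_rightInverse_of_surjective _ (LinearMap.range_eq_top.2 hq)
  have hqj : ∀ y, q (j y) = y := fun y => LinearMap.congr_fun hj y
  have hqi : ∀ x, q (i x) = 0 := fun x =>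
    hqX _ (Submodule.mem_sup_left (LinearMap.mem_range_self i x))
  have hqA : ∀ x, q (A (i x)) = 0 := fun x =>
    hqX _ (Submodule.mem_sup_right (LinearMap.mem_range_self (A ∘ₗ i) x))
  have := Displaces.of_finrank (A := exteriorPower.map 2 A) (tensorToWedge i j)
    (wedgeToTensor p q)
    (fun x => by
      induction x with
      | zero => simp
      | tmul x y => simp [hpi, hqi, hqj]
      | add x y hx hy => rw [map_add, map_add, hx, hy])
    (fun x => by
      induction x with
      | zero => simp
      | tmul x y =>
        rw [tensorToWedge_tmul, exteriorPower.map_apply_ιMulti]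
        have : (A ∘ ![i x, j y] : Fin 2 → U) = ![A (i x), A (j y)] := by
          ext t
          fin_cases t <;> rfl
        rw [this]
        simp [hpA, hqA]
      | add x y hx hy => rw [map_add, map_add, map_add, hx, hy, add_zero])
  simpa [Module.finrank_tensorProduct] using this

end LinearAlgebra
-- Codimension of the fixed space of a nontrivial element
section Codimension

variable {F : Type u} [Field F] {V : Type v} [AddCommGroup V] [Module F V]
  {W : Type w} [AddCommGroup W] [Module F W]

/-- The dimension of the residual space, the range of `T - 1`. -/
noncomputable def residualDim (T : Module.End F V) : ℕ :=
  Module.finrank F (LinearMap.range (T - 1))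

theorem Displaces.prodMap_left {A : Module.End F V} {k : ℕ} (h : Displaces A k)
    (B : Module.End F W) : Displaces (A.prodMap B : Module.End F (V × W)) k := by
  obtain ⟨i, p, hpi, hpA⟩ := h
  exact ⟨LinearMap.inl F V W ∘ₗ i, p ∘ₗ LinearMap.fst F V W, by simp [hpi], by simp [hpA]⟩

theorem exteriorPower_map_smul_one (k : ℕ) (a : F) :
    exteriorPower.map k (a • (1 : Module.End F V)) = a ^ k • LinearMap.id := by
  apply exteriorPower.linearMap_ext
  ext v : 1
  have : ((a • (1 : Module.End F V)) ∘ v : Fin k → V) = fun t => a • v t := rfl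
  rw [LinearMap.compAlternatingMap_apply, exteriorPower.map_apply_ιMulti, this,
    LinearMap.compAlternatingMap_apply]
  simpa using (exteriorPower.ιMulti F k).toMultilinearMap.map_smul_univ (fun _ => a) v

variable [FiniteDimensional F V] [FiniteDimensional F W]

theorem finrank_wedgeSum :
    Module.finrank F (WedgeSum F V) =
      (Module.finrank F V).choose 2 + Module.finrank F V := by
  rw [Module.finrank_prod, exteriorPower.finrank_eq]

theorem sq_le_two_mul_choose_two_add (n : ℕ) : n ^ 2 ≤ 2 * (n.choose 2 + n) := by
  rw [Nat.choose_two_right, mul_add, Nat.mul_div_cancel' (Nat.even_mul_pred_self n).two_dvd]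
  cases n with
  | zero => simp
  | succ n => simp only [Nat.add_sub_cancel]; nlinarith

theorem le_residualDim_map_smul_one {U : Type*} [AddCommGroup U] [Module F U]
    [FiniteDimensional F U] {M : Type*} [AddCommGroup M] [Module F M] (A : Module.End F U)
    {a b : F} (hab : b * a ≠ 1) (i : M →ₗ[F] U) (p : U →ₗ[F] M) (hpi : ∀ x, p (i x) = x)
    (hpA : ∀ x, p (A (i x)) = a • x) :
    Module.finrank F M * Module.finrank F W ≤
      residualDim (TensorProduct.map A (b • (1 : Module.End F W))) := by
  have := finrank_le_finrank_range_of_comp (TensorProduct.map A (b • (1 : Module.End F W)) - 1)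
    (TensorProduct.map i (LinearMap.id (M := W))) (TensorProduct.map p (LinearMap.id (M := W)))
    (sub_ne_zero.2 hab) (fun x => by
      induction x with
      | zero => simp
      | tmul x y => simp [hpi, hpA, TensorProduct.smul_tmul', smul_smul, sub_smul]
      | add x y hx hy => rw [map_add, map_add, map_add, hx, hy, smul_add])
  rwa [Module.finrank_tensorProduct] at this

theorem codim_of_scalar (hn : 3 ≤ Module.finrank F V) (P : LinearMap.GeneralLinearGroup F V)
    (Q : LinearMap.GeneralLinearGroup F W) (hPQ : (P, Q) ≠ 1) {a b : F}
    (ha : (P : Module.End F V) = a • 1) (hb : (Q : Module.End F W) = b • 1) :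
    Module.finrank F V * Module.finrank F W ≤
      residualDim (F := F) (V := WedgeSum F V ⊗[F] W) (tensorRep F V W (P, Q)) := by
  have hT : tensorRep F V W (P, Q) =
      TensorProduct.map ((exteriorPower.map 2 (P : V →ₗ[F] V)).prodMap (P : V →ₗ[F] V))
        (Q : W →ₗ[F] W) := rfl
  rw [hT, ha, hb, exteriorPower_map_smul_one]
  by_cases hab : b * a = 1
  -- The action on `V ⊗ W` is trivial here, so the action on `(V ∧ V) ⊗ W` is not; `n ≥ 3` gives
  -- `n.choose 2 ≥ n`.
  · have ha1 : b * a ^ 2 ≠ 1 := by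
      rw [pow_two, ← mul_assoc, hab, one_mul]
      rintro rfl
      rw [mul_one] at hab
      subst hab
      refine hPQ (Prod.ext (Units.ext ?_) (Units.ext ?_))
      · simpa using ha
      · simpa using hb
    have h := le_residualDim_map_smul_one (W := W) ((a ^ 2 • (LinearMap.id (M := ⋀[F]^2 V))).prodMap
      (a • (1 : Module.End F V))) ha1 (LinearMap.inl F (⋀[F]^2 V) V)
      (LinearMap.fst F (⋀[F]^2 V) V) (by simp) (by simp)
    rw [exteriorPower.finrank_eq] at h
    refine le_trans (Nat.mul_le_mul_right _ ?_) h
    obtain ⟨k, hk⟩ := Nat.exists_eq_add_of_le hn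
    rw [hk, Nat.choose_two_right, Nat.le_div_iff_mul_le two_pos]
    have : 3 + k - 1 = 2 + k := by omega
    rw [this]
    exact Nat.mul_le_mul_left _ (by omega)
  · exact le_residualDim_map_smul_one (W := W) ((a ^ 2 • (LinearMap.id (M := ⋀[F]^2 V))).prodMap
      (a • (1 : Module.End F V))) hab (LinearMap.inr F (⋀[F]^2 V) V)
      (LinearMap.snd F (⋀[F]^2 V) V) (by simp) (by simp)

/-- Lower bounds for the codimension of the space fixed by `g ≠ 1` in terms of the distances of the
components of `g` to the scalars. -/
theorem exists_codim_bounds (hn : 4 ≤ Module.finrank F V)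
    (g : LinearMap.GeneralLinearGroup F V × LinearMap.GeneralLinearGroup F W) (hg : g ≠ 1) :
    ∃ a b : F, ∃ r s k : ℕ,
      r = Module.finrank F (LinearMap.range ((g.1 : Module.End F V) - a • 1)) ∧
      s = Module.finrank F (LinearMap.range ((g.2 : Module.End F W) - b • 1)) ∧
      k = residualDim (F := F) (V := WedgeSum F V ⊗[F] W) (tensorRep F V W g) ∧
      r * (Module.finrank F V * Module.finrank F W) ≤ 16 * k ∧
      s * Module.finrank F V ^ 2 ≤ 6 * k ∧
      (r = 0 → s = 0 → Module.finrank F V * Module.finrank F W ≤ k) := by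
  obtain ⟨P, Q⟩ := g
  obtain ⟨a, t, hr, hP⟩ := exists_displaces (P : Module.End F V)
  obtain ⟨b, t', hs, hQ⟩ := exists_displaces (Q : Module.End F W)
  refine ⟨a, b, _, _, _, rfl, rfl, rfl, ?_, ?_, fun h1 h2 => ?_⟩
  · set n := Module.finrank F V
    have ht := hP.mono (min_le_left t (n / 4))
    -- Truncating at `n / 4` leaves a complement of dimension `n - 2 * k ≥ n / 2`. It costs little:
    -- `r ≤ 3 * t`, and `r ≤ n ≤ 8 * (n / 4)` because `n ≥ 4`. Hence the constant `16 = 8 * 2`.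
    set k := min t (n / 4) with hk
    have h := ((ht.exteriorPower_two (l := n - 2 * k) (by omega)).prodMap_left
      (P : Module.End F V)).le_finrank_range_map_sub_one (Q : Module.End F W)
    have hrn : Module.finrank F (LinearMap.range ((P : Module.End F V) - a • 1)) ≤ n :=
      Submodule.finrank_le _
    have hrk : Module.finrank F (LinearMap.range ((P : Module.End F V) - a • 1)) ≤ 8 * k := by
      omega
    have hnk : n ≤ 2 * (n - 2 * k) := by omega
    calc _ ≤ (8 * k) * (2 * (n - 2 * k) * Module.finrank F W) := by gcongr
      _ = 16 * (k * (n - 2 * k) * Module.finrank F W) := by ring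
      _ ≤ _ := Nat.mul_le_mul_left _ h
  · have h := hQ.le_finrank_range_map_sub_one_right (wedgeSumRep F V P)
    rw [finrank_wedgeSum] at h
    set n := Module.finrank F V
    calc _ ≤ (3 * t') * (2 * (n.choose 2 + n)) := by
          gcongr
          exact sq_le_two_mul_choose_two_add n
      _ = 6 * (t' * (n.choose 2 + n)) := by ring
      _ ≤ _ := Nat.mul_le_mul_left _ h
  · apply codim_of_scalar (by omega) P Q hg (a := a) (b := b)
    · rwa [Submodule.finrank_eq_zero, LinearMap.range_eq_bot, sub_eq_zero] at h1
    · rwa [Submodule.finrank_eq_zero, LinearMap.range_eq_bot, sub_eq_zero] at h2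

end Codimension

/-! ### Counting endomorphisms by rank, and Burnside's lemma -/

section Counting

variable {F : Type u} [Field F] [Finite F] {V : Type v} [AddCommGroup V] [Module F V]
  [FiniteDimensional F V]

/-- An endomorphism of rank `r` factors through `F ^ r`, and the two factors determine it. -/
theorem card_finrank_range_eq_le (r : ℕ) :
    Nat.card {D : Module.End F V // Module.finrank F (LinearMap.range D) = r} ≤
      Nat.card F ^ (2 * Module.finrank F V * r) := by
  have hfac : ∀ D : {D : Module.End F V // Module.finrank F (LinearMap.range D) = r},
      ∃ LR : ((Fin r → F) →ₗ[F] V) × (V →ₗ[F] (Fin r → F)), LR.1 ∘ₗ LR.2 = D.1 := by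
    rintro ⟨D, hD⟩
    let e : LinearMap.range D ≃ₗ[F] (Fin r → F) :=
      LinearEquiv.ofFinrankEq _ _ (by rw [hD, Module.finrank_fin_fun])
    refine ⟨((LinearMap.range D).subtype ∘ₗ e.symm.toLinearMap,
      e.toLinearMap ∘ₗ D.rangeRestrict), ?_⟩
    ext x
    simp
  choose f hf using hfac
  have : Finite (((Fin r → F) →ₗ[F] V) × (V →ₗ[F] (Fin r → F))) := Module.finite_of_finite F
  have hinj : Function.Injective f := fun D D' h => Subtype.ext (by rw [← hf, ← hf, h])
  refine (Nat.card_le_card_of_injective f hinj).trans_eq ?_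
  rw [Module.natCard_eq_pow_finrank (K := F), Module.finrank_prod, Module.finrank_linearMap,
    Module.finrank_linearMap, Module.finrank_fin_fun]
  congr 1
  ring

/-- Each of the `n + 1` possible ranks contributes at most 1. -/
theorem sum_end_inv_pow_le [Fintype (Module.End F V)] :
    ∑ D : Module.End F V, ((Nat.card F : ℝ) ^
        (2 * Module.finrank F V * Module.finrank F (LinearMap.range D)))⁻¹ ≤
      Module.finrank F V + 1 := by
  classical
  have hq : 0 < (Nat.card F : ℝ) := by exact_mod_cast Nat.card_pos
  set n := Module.finrank F V
  rw [← Finset.sum_fiberwise_of_maps_to (s := Finset.univ) (t := Finset.range (n + 1))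
    (g := fun D : Module.End F V => Module.finrank F (LinearMap.range D))
    (fun D _ => Finset.mem_range.2 (Nat.lt_succ_of_le (Submodule.finrank_le _)))]
  have : ∀ r ∈ Finset.range (n + 1),
      (∑ D : Module.End F V with Module.finrank F (LinearMap.range D) = r,
        ((Nat.card F : ℝ) ^ (2 * n * Module.finrank F (LinearMap.range D)))⁻¹) ≤ 1 := by
    intro r _
    rw [Finset.sum_congr rfl (g := fun _ => ((Nat.card F : ℝ) ^ (2 * n * r))⁻¹)
      (fun D hD => by rw [(Finset.mem_filter.1 hD).2]), Finset.sum_const, nsmul_eq_mul,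
      ← div_eq_mul_inv, div_le_one (pow_pos hq _)]
    have h := card_finrank_range_eq_le (F := F) (V := V) r
    rw [Nat.card_eq_fintype_card, Fintype.card_subtype] at h
    exact_mod_cast h
  refine (Finset.sum_le_sum this).trans ?_
  simp

theorem sum_gl_inv_pow_le [Fintype F] [Fintype (LinearMap.GeneralLinearGroup F V)] :
    ∑ P : LinearMap.GeneralLinearGroup F V, ∑ a : F, ((Nat.card F : ℝ) ^
        (2 * Module.finrank F V *
          Module.finrank F (LinearMap.range ((P : Module.End F V) - a • 1))))⁻¹ ≤
      Nat.card F * (Module.finrank F V + 1) := by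
  classical
  have : Finite (Module.End F V) := Module.finite_of_finite F
  have := Fintype.ofFinite (Module.End F V)
  rw [Finset.sum_comm]
  have h : ∀ a ∈ (Finset.univ : Finset F), ∑ P : LinearMap.GeneralLinearGroup F V,
      ((Nat.card F : ℝ) ^ (2 * Module.finrank F V *
          Module.finrank F (LinearMap.range ((P : Module.End F V) - a • 1))))⁻¹ ≤
      (Module.finrank F V + 1 : ℝ) := by
    intro a _
    refine le_trans ?_ (sum_end_inv_pow_le (F := F) (V := V))
    let e : LinearMap.GeneralLinearGroup F V ↪ Module.End F V :=
      ⟨fun P => (P : Module.End F V) - a • 1, fun P P' h => Units.ext (sub_left_injective h)⟩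
    exact (Finset.sum_map Finset.univ e (fun D => ((Nat.card F : ℝ) ^
        (2 * Module.finrank F V * Module.finrank F (LinearMap.range D)))⁻¹)).symm.trans_le
      (Finset.sum_le_sum_of_subset_of_nonneg (Finset.subset_univ _)
        (fun _ _ _ => by positivity))
  refine (Finset.sum_le_sum h).trans ?_
  simp [Nat.card_eq_fintype_card, mul_add]

/-- Burnside's lemma for a linear representation over a finite field. -/
theorem numOrbits_vectorAction_mul_card {G : Type w} [Group G] [Fintype G]
    (ρ : Representation F G V) :
    (numOrbits (vectorAction ρ) : ℝ) * Nat.card G =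
      (Nat.card F : ℝ) ^ Module.finrank F V *
        ∑ g : G, ((Nat.card F : ℝ) ^ residualDim (ρ g))⁻¹ := by
  classical
  have hq : 0 < (Nat.card F : ℝ) := by exact_mod_cast Nat.card_pos
  have : Finite V := Module.finite_of_finite F
  let := vectorAction ρ
  have := Fintype.ofFinite V
  have := Fintype.ofFinite (MulAction.orbitRel.Quotient G V)
  have := fun g : G => Fintype.ofFinite (MulAction.fixedBy V g)
  have hB := MulAction.sum_card_fixedBy_eq_card_orbits_mul_card_group G V
  rw [numOrbits, Nat.card_eq_fintype_card, Nat.card_eq_fintype_card (α := G), ← Nat.cast_mul]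
  refine (congrArg (Nat.cast : ℕ → ℝ) hB.symm).trans ?_
  rw [Nat.cast_sum, Finset.mul_sum]
  refine Finset.sum_congr rfl fun g _ => ?_
  have hset : MulAction.fixedBy V g = (LinearMap.ker (ρ g - 1) : Set V) := by
    ext x
    rw [MulAction.mem_fixedBy, SetLike.mem_coe, LinearMap.mem_ker, LinearMap.sub_apply,
      sub_eq_zero]
    rfl
  rw [← Nat.card_eq_fintype_card, hset]
  have hk : Nat.card (LinearMap.ker (ρ g - 1) : Set V) =
      Nat.card F ^ Module.finrank F (LinearMap.ker (ρ g - 1)) :=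
    Module.natCard_eq_pow_finrank (K := F) (V := LinearMap.ker (ρ g - 1))
  rw [hk, Nat.cast_pow, eq_mul_inv_iff_mul_eq₀ (pow_pos hq _).ne', ← pow_add, add_comm, residualDim,
    LinearMap.finrank_range_add_finrank_ker]

end Counting

/-! ### From subspaces to tensors by contraction -/

section Subspaces

variable {F : Type u} [Field F] {M : Type v} [AddCommGroup M] [Module F M]
  {W : Type w} [AddCommGroup W] [Module F W]

/-- The linear map `W* → M` given by contraction with a tensor in `M ⊗ W`. -/
noncomputable def contract (x : M ⊗[F] W) : Module.Dual F W →ₗ[F] M :=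
  (TensorProduct.rid F M).toLinearMap ∘ₗ (LinearMap.lTensorHom M).flip x

theorem contract_tmul (x : M) (y : W) (f : Module.Dual F W) :
    contract (x ⊗ₜ y) f = f y • x := by
  simp [contract]

theorem contract_add (x y : M ⊗[F] W) : contract (x + y) = contract x + contract y := by
  simp [contract, LinearMap.comp_add]

theorem contract_map (A : Module.End F M) (B : Module.End F W) (x : M ⊗[F] W)
    (f : Module.Dual F W) :
    contract (TensorProduct.map A B x) f = A (contract x (f ∘ₗ B)) := by
  induction x with
  | zero => simp [contract]
  | tmul x y => simp [contract_tmul]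
  | add x y hx hy =>
    rw [map_add, contract_add, contract_add, LinearMap.add_apply, LinearMap.add_apply, hx, hy,
      map_add]

theorem range_contract_map (A : Module.End F M) (Q : LinearMap.GeneralLinearGroup F W)
    (x : M ⊗[F] W) :
    LinearMap.range (contract (TensorProduct.map A (Q : Module.End F W) x)) =
      (LinearMap.range (contract x)).map A := by
  apply le_antisymm
  · rintro _ ⟨f, rfl⟩
    rw [contract_map]
    exact Submodule.mem_map_of_mem (LinearMap.mem_range_self _ _)
  · rintro _ ⟨_, ⟨f, rfl⟩, rfl⟩
    refine ⟨f ∘ₗ (Q⁻¹ : LinearMap.GeneralLinearGroup F W), ?_⟩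
    rw [contract_map, LinearMap.comp_assoc, ← Module.End.mul_eq_comp, ← Units.val_mul,
      inv_mul_cancel, Units.val_one, Module.End.one_eq_id, LinearMap.comp_id]

theorem exists_range_contract_eq [FiniteDimensional F M] [FiniteDimensional F W]
    (S : Gr F M (Module.finrank F W)) :
    ∃ x : M ⊗[F] W, LinearMap.range (contract x) = S.1 := by
  obtain ⟨S, hS⟩ := S
  let b := Module.finBasisOfFinrankEq F S hS
  let w := Module.finBasis F W
  have hsum : ∀ (s : Finset (Fin (Module.finrank F W))) (f : Module.Dual F W),
      contract (∑ j ∈ s, (b j : M) ⊗ₜ[F] w j) f = ∑ j ∈ s, f (w j) • (b j : M) := by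
    intro s f
    induction s using Finset.cons_induction with
    | empty => simp [contract]
    | cons j s hj ih =>
      rw [Finset.sum_cons, Finset.sum_cons, contract_add, LinearMap.add_apply, ih, contract_tmul]
  refine ⟨∑ j, (b j : M) ⊗ₜ[F] w j, le_antisymm ?_ fun s hs => ?_⟩
  · rintro _ ⟨f, rfl⟩
    rw [hsum]
    exact S.sum_mem fun j _ => S.smul_mem _ (b j).2
  · refine ⟨w.constr F fun j => b.repr ⟨s, hs⟩ j, ?_⟩
    rw [hsum]
    simp only [Module.Basis.constr_basis]
    simpa only [map_sum, map_smul, Submodule.subtype_apply] using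
      congrArg S.subtype (b.sum_repr ⟨s, hs⟩)

/-- The graphs of the linear maps `F ^ m → F ^ (dim M - m)` are distinct subspaces of dimension `m`.
-/
theorem pow_le_card_gr [Finite F] [FiniteDimensional F M] {m : ℕ}
    (hm : m ≤ Module.finrank F M) :
    Nat.card F ^ (m * (Module.finrank F M - m)) ≤ Nat.card (Gr F M m) := by
  have : Finite M := Module.finite_of_finite F
  let e : M ≃ₗ[F] (Fin m → F) × (Fin (Module.finrank F M - m) → F) :=
    LinearEquiv.ofFinrankEq _ _ (by
      rw [Module.finrank_prod, Module.finrank_fin_fun, Module.finrank_fin_fun]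
      omega)
  have hinj : ∀ f : (Fin m → F) →ₗ[F] (Fin (Module.finrank F M - m) → F),
      Function.Injective (e.symm.toLinearMap ∘ₗ LinearMap.id.prod f) := fun f x y h =>
    congrArg Prod.fst (e.symm.injective h)
  let G : ((Fin m → F) →ₗ[F] (Fin (Module.finrank F M - m) → F)) → Gr F M m := fun f =>
    ⟨LinearMap.range (e.symm.toLinearMap ∘ₗ LinearMap.id.prod f), by
      rw [LinearMap.finrank_range_of_inj (hinj f), Module.finrank_fin_fun]⟩
  have hG : Function.Injective G := by
    intro f f' h
    refine LinearMap.ext fun x => ?_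
    have hx : e.symm (x, f x) ∈ (G f').1 := h ▸ LinearMap.mem_range_self _ x
    obtain ⟨y, hy⟩ := hx
    have hy' := e.symm.injective hy
    have h1 : y = x := congrArg Prod.fst hy'
    have h2 : f' y = f x := congrArg Prod.snd hy'
    rw [← h2, h1]
  have := Nat.card_le_card_of_injective G hG
  rwa [Module.natCard_eq_pow_finrank (K := F), Module.finrank_linearMap, Module.finrank_fin_fun,
    Module.finrank_fin_fun] at this

theorem natCard_matrix_gl [FiniteDimensional F W] :
    Nat.card (Matrix.GeneralLinearGroup (Fin (Module.finrank F W)) F) =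
      Nat.card (LinearMap.GeneralLinearGroup F W) :=
  Nat.card_congr (Matrix.GeneralLinearGroup.toLin.trans
    (LinearMap.GeneralLinearGroup.congrLinearEquiv
      (Module.finBasis F W).equivFun.symm)).toEquiv

variable {V : Type v} [AddCommGroup V] [Module F V]

/-- Pick for each orbit a tensor whose contraction has a representative as its image. If two such
tensors are equivalent under `(P, Q)`, then `P` carries one image to the other. -/
theorem gSubspace_le_gTensor [Finite F] [FiniteDimensional F V] [FiniteDimensional F W] :
    gSubspace F V (Module.finrank F W) ≤ gTensor F V W := by
  have : Finite (WedgeSum F V ⊗[F] W) := Module.finite_of_finite F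
  choose t ht using exists_range_contract_eq (F := F) (M := WedgeSum F V) (W := W)
  let a := subspaceAction (wedgeSumRep F V) (Module.finrank F W)
  let b := vectorAction (tensorRep F V W)
  let f : MulAction.orbitRel.Quotient (LinearMap.GeneralLinearGroup F V)
      (Gr F (WedgeSum F V) (Module.finrank F W)) →
      MulAction.orbitRel.Quotient (LinearMap.GeneralLinearGroup F V ×
        LinearMap.GeneralLinearGroup F W) (WedgeSum F V ⊗[F] W) :=
    fun S => Quotient.mk _ (t S.out)
  refine Nat.card_le_card_of_injective f fun S T h => ?_
  obtain ⟨⟨P, Q⟩, hg⟩ := MulAction.orbitRel_apply.1 (Quotient.exact h)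
  have hg' : TensorProduct.map (wedgeSumRep F V P) (Q : Module.End F W) (t T.out) = t S.out := hg
  have hr := range_contract_map (wedgeSumRep F V P) Q (t T.out)
  rw [hg', ht, ht] at hr
  rw [← S.out_eq, ← T.out_eq]
  exact Quotient.sound (MulAction.orbitRel_apply.2 ⟨P, Subtype.ext hr.symm⟩)

end Subspaces

/-! ### Summation over the group -/

section Estimate

variable {F : Type u} [Field F] [Finite F] {V : Type v} [AddCommGroup V] [Module F V]
  [FiniteDimensional F V] {W : Type w} [AddCommGroup W] [Module F W] [FiniteDimensional F W]

theorem exists_inv_pow_residualDim_le {δ : ℝ} (hδ : 0 < δ)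
    (hδ6 : δ ≤ 1 / 6) (hn : 4 ≤ Module.finrank F V)
    (hδm : 16 * δ * Module.finrank F V ≤ Module.finrank F W)
    (hnl : 8 * (Module.finrank F V : ℝ) ≤ δ * (Module.finrank F V : ℝ) ^ 2)
    (hml : 8 * (Module.finrank F W : ℝ) ≤ δ * (Module.finrank F V : ℝ) ^ 2)
    (g : LinearMap.GeneralLinearGroup F V × LinearMap.GeneralLinearGroup F W) (hg : g ≠ 1) :
    ∃ a b : F, ((Nat.card F : ℝ) ^
        residualDim (F := F) (V := WedgeSum F V ⊗[F] W) (tensorRep F V W g))⁻¹ ≤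
      (Nat.card F : ℝ) ^ (-(δ * (Module.finrank F V : ℝ) ^ 2 / 4)) *
        (((Nat.card F : ℝ) ^ (2 * Module.finrank F V *
            Module.finrank F (LinearMap.range ((g.1 : Module.End F V) - a • 1))))⁻¹ *
          ((Nat.card F : ℝ) ^ (2 * Module.finrank F W *
            Module.finrank F (LinearMap.range ((g.2 : Module.End F W) - b • 1))))⁻¹) := by
  have hq : 1 < (Nat.card F : ℝ) := by exact_mod_cast Finite.one_lt_card
  have hq0 := zero_lt_one.trans hq
  obtain ⟨a, b, r, s, k, hr, hs, hk, h1, h2, h3⟩ := exists_codim_bounds hn g hg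
  refine ⟨a, b, ?_⟩
  rw [← hr, ← hs, ← hk]
  generalize (Nat.card F : ℝ) = q at *
  generalize Module.finrank F V = n at *
  generalize Module.finrank F W = m at *
  have h1' : (r : ℝ) * (n * m) ≤ 16 * k := by exact_mod_cast h1
  have h2' : (s : ℝ) * (n : ℝ) ^ 2 ≤ 6 * k := by exact_mod_cast h2
  have hr1 : δ * (n : ℝ) ^ 2 * r ≤ k := by
    have : 16 * δ * n * (r * n) ≤ m * (r * n) := by gcongr
    linarith
  have hs1 : δ * (n : ℝ) ^ 2 * s ≤ k := by
    have : δ * (s * (n : ℝ) ^ 2) ≤ 1 / 6 * (s * (n : ℝ) ^ 2) := by gcongr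
    linarith
  have h01 : δ * (n : ℝ) ^ 2 ≤ k := by
    have hδn : 0 ≤ δ * (n : ℝ) ^ 2 := by positivity
    rcases Nat.eq_zero_or_pos r with hr0 | hr0
    · rcases Nat.eq_zero_or_pos s with hs0 | hs0
      · have h3' : (n : ℝ) * m ≤ k := by exact_mod_cast h3 hr0 hs0
        have h4 : 16 * δ * n * n ≤ m * n := by gcongr
        linarith
      · exact (le_mul_of_one_le_right hδn (by exact_mod_cast hs0)).trans hs1
    · exact (le_mul_of_one_le_right hδn (by exact_mod_cast hr0)).trans hr1
  -- Each of the three terms is at most `k / 4`.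
  have hkey : δ * (n : ℝ) ^ 2 / 4 + ((2 * n * r : ℕ) : ℝ) + ((2 * m * s : ℕ) : ℝ) ≤ k := by
    have e1 : 8 * (n : ℝ) * r ≤ δ * (n : ℝ) ^ 2 * r := by gcongr
    have e2 : 8 * (m : ℝ) * s ≤ δ * (n : ℝ) ^ 2 * s := by gcongr
    push_cast
    linarith
  rw [← Real.rpow_natCast q k, ← Real.rpow_natCast q (2 * n * r),
    ← Real.rpow_natCast q (2 * m * s), ← Real.rpow_neg hq0.le,
    ← Real.rpow_neg hq0.le, ← Real.rpow_neg hq0.le, ← Real.rpow_add hq0, ← Real.rpow_add hq0]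
  exact Real.rpow_le_rpow_of_exponent_le hq.le (by linarith)

/-- The scalars `a`, `b` depend on `g`; summing over all of them removes this dependence, and the
double sum factors. -/
theorem sum_prod_le_one_add {G H ι : Type*} [One G] [One H] [Fintype G] [Fintype H] [Fintype ι]
    [Fintype (G × H)]
    {f : G × H → ℝ} {φ : G → ι → ℝ} {ψ : H → ι → ℝ} {ε A B : ℝ} (hε : 0 ≤ ε)
    (hφ : ∀ P a, 0 ≤ φ P a) (hψ : ∀ Q b, 0 ≤ ψ Q b) (h1 : f (1 : G × H) ≤ 1)
    (hf : ∀ g : G × H, g ≠ 1 → ∃ a b, f g ≤ ε * (φ g.1 a * ψ g.2 b))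
    (hA : ∑ P, ∑ a, φ P a ≤ A) (hB : ∑ Q, ∑ b, ψ Q b ≤ B) :
    ∑ g : G × H, f g ≤ 1 + ε * (A * B) := by
  classical
  have hφ0 : ∀ P, 0 ≤ ∑ a, φ P a := fun P => Finset.sum_nonneg fun a _ => hφ P a
  have hψ0 : ∀ Q, 0 ≤ ∑ b, ψ Q b := fun Q => Finset.sum_nonneg fun b _ => hψ Q b
  rw [← Finset.add_sum_erase _ _ (Finset.mem_univ (1 : G × H))]
  refine add_le_add h1 ?_
  calc _ ≤ ∑ g ∈ Finset.univ.erase (1 : G × H), ε * ((∑ a, φ g.1 a) * ∑ b, ψ g.2 b) := by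
        refine Finset.sum_le_sum fun g hg => ?_
        obtain ⟨a, b, hab⟩ := hf g (Finset.ne_of_mem_erase hg)
        refine hab.trans (mul_le_mul_of_nonneg_left (mul_le_mul ?_ ?_ (hψ _ _) (hφ0 _)) hε)
        · exact Finset.single_le_sum (f := φ g.1) (fun a _ => hφ _ a) (Finset.mem_univ a)
        · exact Finset.single_le_sum (f := ψ g.2) (fun b _ => hψ _ b) (Finset.mem_univ b)
    _ ≤ ∑ g : G × H, ε * ((∑ a, φ g.1 a) * ∑ b, ψ g.2 b) :=
        Finset.sum_le_sum_of_subset_of_nonneg (Finset.erase_subset _ _) fun g _ _ =>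
          mul_nonneg hε (mul_nonneg (hφ0 _) (hψ0 _))
    _ = ε * ((∑ P, ∑ a, φ P a) * ∑ Q, ∑ b, ψ Q b) := by
        rw [← Finset.mul_sum, Finset.sum_mul_sum, ← Finset.sum_product']
        congr 1
        exact Finset.sum_congr (by ext; simp) fun _ _ => rfl
    _ ≤ _ := mul_le_mul_of_nonneg_left
        (mul_le_mul hA hB (Finset.sum_nonneg fun _ _ => hψ0 _)
          ((Finset.sum_nonneg fun _ _ => hφ0 _).trans hA)) hε

/-- An upper bound for the average number of fixed tensors, relative to that of the identity. -/
theorem sum_inv_pow_residualDim_le {δ : ℝ} (hδ : 0 < δ)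
    (hδ6 : δ ≤ 1 / 6) (hn : 4 ≤ Module.finrank F V)
    (hδm : 16 * δ * Module.finrank F V ≤ Module.finrank F W)
    (hnl : 8 * (Module.finrank F V : ℝ) ≤ δ * (Module.finrank F V : ℝ) ^ 2)
    (hml : 8 * (Module.finrank F W : ℝ) ≤ δ * (Module.finrank F V : ℝ) ^ 2)
    [Fintype (LinearMap.GeneralLinearGroup F V × LinearMap.GeneralLinearGroup F W)] :
    ∑ g : LinearMap.GeneralLinearGroup F V × LinearMap.GeneralLinearGroup F W,
      ((Nat.card F : ℝ) ^
        residualDim (F := F) (V := WedgeSum F V ⊗[F] W) (tensorRep F V W g))⁻¹ ≤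
      1 + (Nat.card F : ℝ) ^ (-(δ * (Module.finrank F V : ℝ) ^ 2 / 4)) *
        ((Nat.card F * (Module.finrank F V + 1)) * (Nat.card F * (Module.finrank F W + 1))) := by
  have hq : 1 ≤ (Nat.card F : ℝ) := by exact_mod_cast Nat.card_pos (α := F)
  have := Fintype.ofFinite F
  have : Finite (Module.End F V) := Module.finite_of_finite F
  have : Finite (Module.End F W) := Module.finite_of_finite F
  have := Fintype.ofFinite (LinearMap.GeneralLinearGroup F V)
  have := Fintype.ofFinite (LinearMap.GeneralLinearGroup F W)
  exact sum_prod_le_one_add (by positivity) (fun _ _ => by positivity) (fun _ _ => by positivity)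
    (inv_le_one_of_one_le₀ (one_le_pow₀ hq))
    (exists_inv_pow_residualDim_le hδ hδ6 hn hδm hnl hml) sum_gl_inv_pow_le sum_gl_inv_pow_le

/-- The bound for the number of orbits on `(V ∧ V ⊕ V) ⊗ W`. -/
theorem gTensor_le {δ A : ℝ} (hδ : 0 < δ) (hδ6 : δ ≤ 1 / 6) (hn : 4 ≤ Module.finrank F V)
    (hδm : 16 * δ * Module.finrank F V ≤ Module.finrank F W)
    (hA : 0 ≤ A) (hmA : (Module.finrank F W : ℝ) ≤ A * Module.finrank F V)
    (hAn : 8 * (A + 3) ≤ δ * Module.finrank F V) :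
    (gTensor F V W : ℝ) ≤
      ((Nat.card F : ℝ) - 1 + 1 / (Nat.card F : ℝ) ^ (δ / 8 * (Module.finrank F V : ℝ) ^ 2)) *
        ((Nat.card F : ℝ) ^ (((Module.finrank F V).choose 2 + Module.finrank F V) *
            Module.finrank F W) /
          ((Nat.card (LinearMap.GeneralLinearGroup F V) : ℝ) *
            (Nat.card (LinearMap.GeneralLinearGroup F W) : ℝ))) := by
  have hq : 2 ≤ (Nat.card F : ℝ) := by exact_mod_cast Finite.one_lt_card (α := F)
  have hq0 : 0 < (Nat.card F : ℝ) := by linarith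
  have : Finite (Module.End F V) := Module.finite_of_finite F
  have : Finite (Module.End F W) := Module.finite_of_finite F
  have := Fintype.ofFinite (LinearMap.GeneralLinearGroup F V × LinearMap.GeneralLinearGroup F W)
  have hB := numOrbits_vectorAction_mul_card (V := WedgeSum F V ⊗[F] W) (tensorRep F V W)
  have hn4 : (4 : ℝ) ≤ Module.finrank F V := by exact_mod_cast hn
  have hAn2 : 8 * (A + 3) * (Module.finrank F V : ℝ) ≤ δ * (Module.finrank F V : ℝ) ^ 2 := by
    rw [pow_two, ← mul_assoc]
    gcongr
  have hAn0 : 0 ≤ A * (Module.finrank F V : ℝ) := by positivity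
  have hS := sum_inv_pow_residualDim_le (F := F) (V := V) (W := W) hδ hδ6 hn hδm
    (by linarith) (by linarith)
  rw [Module.finrank_tensorProduct, finrank_wedgeSum, Nat.card_prod, Nat.cast_mul] at hB
  set q : ℝ := (Nat.card F : ℝ)
  set n := Module.finrank F V
  set m := Module.finrank F W
  have hlin : ∀ l : ℕ, (l + 1 : ℝ) ≤ q ^ (l : ℝ) := fun l => by
    rw [Real.rpow_natCast]
    have h : l + 1 ≤ 2 ^ l := Nat.lt_two_pow_self
    calc (l + 1 : ℝ) ≤ 2 ^ l := by exact_mod_cast h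
      _ ≤ q ^ l := by gcongr
  -- The polynomial factors are at most `q ^ (n + m + 2)`, and `n + m + 2 ≤ (A + 3) * n ≤ δ * n ^ 2
  -- / 8`, so half of the exponent survives.
  have herr : q ^ (-(δ * (n : ℝ) ^ 2 / 4)) * ((q * (n + 1)) * (q * (m + 1))) ≤
      1 / q ^ (δ / 8 * (n : ℝ) ^ 2) := by
    calc _ ≤ q ^ (-(δ * (n : ℝ) ^ 2 / 4)) *
          ((q ^ (1 : ℝ) * q ^ (n : ℝ)) * (q ^ (1 : ℝ) * q ^ (m : ℝ))) := by
          rw [Real.rpow_one]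
          gcongr
          · exact hlin n
          · exact hlin m
      _ = q ^ (-(δ * (n : ℝ) ^ 2 / 4) + ((1 + n) + (1 + m))) := by
          rw [← Real.rpow_add hq0, ← Real.rpow_add hq0, ← Real.rpow_add hq0,
            ← Real.rpow_add hq0]
      _ ≤ q ^ (-(δ / 8 * (n : ℝ) ^ 2)) :=
          Real.rpow_le_rpow_of_exponent_le (by linarith) (by linarith)
      _ = _ := by rw [Real.rpow_neg hq0.le, one_div]
  have hG : 0 < (Nat.card (LinearMap.GeneralLinearGroup F V) : ℝ) *
      (Nat.card (LinearMap.GeneralLinearGroup F W) : ℝ) :=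
    mul_pos (by exact_mod_cast Nat.card_pos) (by exact_mod_cast Nat.card_pos)
  rw [← mul_div_assoc, le_div_iff₀ hG]
  refine hB.trans_le ?_
  rw [mul_comm]
  gcongr
  -- The term 1 of the identity is at most `q - 1`, as `q ≥ 2`.
  exact hS.trans (by linarith)

/-- The bound for the number of orbits on `m`-dimensional subspaces of `V ∧ V ⊕ V`, deduced from
a bound for the number of orbits on `(V ∧ V ⊕ V) ⊗ W`. -/
theorem gSubspace_le {B : ℝ} (hB : 0 ≤ B)
    (hm : Module.finrank F W ≤ (Module.finrank F V).choose 2 + Module.finrank F V)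
    (h : (gTensor F V W : ℝ) ≤ B *
        ((Nat.card F : ℝ) ^ (((Module.finrank F V).choose 2 + Module.finrank F V) *
            Module.finrank F W) /
          ((Nat.card (LinearMap.GeneralLinearGroup F V) : ℝ) *
            (Nat.card (LinearMap.GeneralLinearGroup F W) : ℝ)))) :
    (gSubspace F V (Module.finrank F W) : ℝ) ≤
      ((Nat.card F : ℝ) ^ (Module.finrank F W ^ 2) /
          (Nat.card (Matrix.GeneralLinearGroup (Fin (Module.finrank F W)) F) : ℝ)) * B *
        ((Nat.card (Gr F (WedgeSum F V) (Module.finrank F W)) : ℝ) /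
          (Nat.card (LinearMap.GeneralLinearGroup F V) : ℝ)) := by
  have hGr := pow_le_card_gr (F := F) (M := WedgeSum F V) (m := Module.finrank F W)
    (by rwa [finrank_wedgeSum])
  rw [finrank_wedgeSum] at hGr
  have hGr' : (Nat.card F : ℝ) ^ (Module.finrank F W *
      ((Module.finrank F V).choose 2 + Module.finrank F V - Module.finrank F W)) ≤
      Nat.card (Gr F (WedgeSum F V) (Module.finrank F W)) := by exact_mod_cast hGr
  have hle : (gSubspace F V (Module.finrank F W) : ℝ) ≤ gTensor F V W := by
    exact_mod_cast gSubspace_le_gTensor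
  refine (hle.trans h).trans ?_
  rw [natCard_matrix_gl]
  obtain ⟨d, hd⟩ := Nat.exists_eq_add_of_le hm
  rw [hd, Nat.add_sub_cancel_left] at hGr'
  rw [hd]
  calc _ = (Nat.card F : ℝ) ^ (Module.finrank F W ^ 2) /
          (Nat.card (LinearMap.GeneralLinearGroup F W) : ℝ) * B *
        ((Nat.card F : ℝ) ^ (Module.finrank F W * d) /
          (Nat.card (LinearMap.GeneralLinearGroup F V) : ℝ)) := by
        rw [add_mul, ← pow_two, mul_comm d, pow_add]
        ring
    _ ≤ _ := by gcongr

end Estimate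

end OrbitCount

/-! ### Choice of the constants -/

theorem mainTheorem5 (C R : ℝ) (hC : 0 < C) :
    ∃ c : ℝ, 0 < c ∧ ∃ N : ℕ, ∀ n m q : ℕ, N ≤ n → (m : ℤ) = ⌈C * (n : ℝ) + R⌉ →
      ∀ (F : Type u) [Field F] [Finite F] (V : Type v) [AddCommGroup V] [Module F V]
        [FiniteDimensional F V] (W : Type w) [AddCommGroup W] [Module F W]
        [FiniteDimensional F W],
        Nat.card F = q → Module.finrank F V = n → Module.finrank F W = m →
        ((OrbitCount.gTensor F V W : ℝ) ≤
            ((q : ℝ) - 1 + 1 / (q : ℝ) ^ (c * (n : ℝ) ^ 2)) *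
              ((q : ℝ) ^ ((n.choose 2 + n) * m) /
                ((Nat.card (LinearMap.GeneralLinearGroup F V) : ℝ) *
                  (Nat.card (LinearMap.GeneralLinearGroup F W) : ℝ)))) ∧
        ((OrbitCount.gSubspace F V m : ℝ) ≤
            ((q : ℝ) ^ (m ^ 2) / (Nat.card (Matrix.GeneralLinearGroup (Fin m) F) : ℝ)) *
              ((q : ℝ) - 1 + 1 / (q : ℝ) ^ (c * (n : ℝ) ^ 2)) *
              ((Nat.card (OrbitCount.Gr F (OrbitCount.WedgeSum F V) m) : ℝ) /
                (Nat.card (LinearMap.GeneralLinearGroup F V) : ℝ))) := by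
  set δ : ℝ := min (C / 32) (1 / 6) with hδdef
  have hδ : 0 < δ := by positivity
  have hδC : δ ≤ C / 32 := min_le_left _ _
  have hδ6 : δ ≤ 1 / 6 := min_le_right _ _
  -- The second bound gives `m ≤ (C + 1) * n`. The third gives `m ≥ C * n / 2 ≥ 16 * δ * n`. The
  -- last is the condition `8 * (A + 3) ≤ δ * n` for `A = C + 1`, and it also yields `2 * m ≤ n ^
  -- 2`, so that subspaces of dimension `m` exist.
  refine ⟨δ / 8, by positivity, max 4 (max ⌈|R| + 1⌉₊ (max ⌈2 * |R| / C⌉₊ ⌈8 * (C + 4) / δ⌉₊)),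
    ?_⟩
  rintro n m q hN hm F _ _ V _ _ _ W _ _ _ rfl rfl rfl
  simp only [max_le_iff, Nat.ceil_le] at hN
  obtain ⟨hn4, hnR, hnC, hnδ⟩ := hN
  rw [div_le_iff₀ hC] at hnC
  rw [div_le_iff₀ hδ] at hnδ
  have hm1 : C * (Module.finrank F V : ℝ) + R ≤ Module.finrank F W := by
    have := Int.le_ceil (C * (Module.finrank F V : ℝ) + R)
    rw [← hm] at this
    exact_mod_cast this
  have hm2 : (Module.finrank F W : ℝ) < C * (Module.finrank F V : ℝ) + R + 1 := by
    have := Int.ceil_lt_add_one (C * (Module.finrank F V : ℝ) + R)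
    rw [← hm] at this
    exact_mod_cast this
  have hn0 : (0 : ℝ) ≤ Module.finrank F V := Nat.cast_nonneg _
  have hRl := neg_abs_le R
  have hRu := le_abs_self R
  have hδn := mul_le_mul_of_nonneg_right hδC hn0
  have hδn6 := mul_le_mul_of_nonneg_right hδ6 hn0
  have hmu : (Module.finrank F W : ℝ) ≤ (C + 1) * Module.finrank F V := by linarith
  have hT := OrbitCount.gTensor_le (F := F) (V := V) (W := W) (A := C + 1) hδ hδ6 hn4
    (by linarith) (by linarith) hmu (by linarith)
  refine ⟨hT, OrbitCount.gSubspace_le ?_ ?_ hT⟩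
  · have : (1 : ℝ) ≤ Nat.card F := by exact_mod_cast Nat.card_pos (α := F)
    have : 0 ≤ 1 / (Nat.card F : ℝ) ^ (δ / 8 * (Module.finrank F V : ℝ) ^ 2) := by positivity
    linarith
  · have h1 := OrbitCount.sq_le_two_mul_choose_two_add (Module.finrank F V)
    have h2 : Module.finrank F W * 2 ≤ Module.finrank F V ^ 2 := by
      have : (Module.finrank F W : ℝ) * 2 ≤ (Module.finrank F V : ℝ) ^ 2 := by
        have : (2 * (C + 1)) * (Module.finrank F V : ℝ) ≤
            Module.finrank F V * Module.finrank F V := by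
          gcongr
          linarith
        linarith
      exact_mod_cast this
    omega
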